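/- Call an oracle machine a multi-stack (equivalently, multi-tape) Turing machine with oracle access to a Boolean function $f:\{0,1\}^n\to\{0,1\}$, running in time polynomial in the length of its input (a run that exceeds its polynomial clock is rejected). Circuits are over constants, NOT, and fan-in-two AND and OR gates; their size is the number of gates. For $X\in\{\mathsf{NP},\mathsf{AM},\mathsf{IP},\mathsf{MIP}\}$, consider polynomial-time oracle machines $M$ interacting with unboundedly powerful provers, who know $f$ and send messages of polynomially bounded length: for $\mathsf{NP}$, $M$ is deterministic and receives one proof string; for $\mathsf{AM}$, $M$ tosses public coins and receives one message; for $\mathsf{IP}$, $M$ tosses private coins and exchanges polynomially many messages with one prover; for $\mathsf{MIP}$, with polynomially many non-communicating provers. Given $s:\mathbb N\to\mathbb N$, say that black-box learning is possible in $X$ for the size bound $s$ if there is such a machine $M$ that, for all $n$ and all $f:\{0,1\}^n\to\{0,1\}$ computed by a circuit of size at most $s(n)$, on input $\langle 0^n,0^{s(n)}\rangle$ with oracle $f$, has the following properties. - Completeness: some prover strategy makes $M$ accept and output a description of a circuit for $f$, with probability at least $2/3$ (with certainty for $\mathsf{NP}$). - Soundness: under every prover strategy, $M$ accepts with an output that is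 not a description of a circuit for $f$ with probability at most $1/3$ (never for $\mathsf{NP}$). **Proposition.** Black-box learning of circuits is impossible in $\mathsf{NP}$, $\mathsf{AM}$, $\mathsf{IP}$ and $\mathsf{MIP}$, already for linear size bounds: there is a constant $c$ such that for every polynomially bounded $s$ with $s(n)\ge cn$ for all $n$, black-box learning is not possible in any of these four classes for the size bound $s$. Moreover, no polynomially bounded set of prover messages can convince a verifier with only oracle access to $f$ that $f$ is identically zero rather than a point function. That is, let $X$ be one of the four classes, let $s$ be polynomially bounded, and let $M$ be a machine as above for $X$. Then for all sufficiently large $n$, the following two conditions do not both hold on input $\langle 0^n,0^{s(n)}\rangle$: 1. when $f\equiv 0$ on $\{0,1\}^n$, some prover strategy makes $M$ accept with probability at least $2/3$ (with certainty for $\mathsf{NP}$); 2. for every $y\in\{0,1\}^n$, when $f$ is the point function with $f(x)=1\iff x=y$, every prover strategy makes $M$ accept with probability at most $1/3$ (never for $\mathsf{NP}$). -/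

import Mathlib

namespace BlackBox

/-! ### Boolean circuits -/

/-- A gate of fan-in at most two whose arguments are taken from `m` earlier wires. -/
inductive Gate (m : ℕ) : Type
  | const (b : Bool)
  | not (i : Fin m)
  | and (i j : Fin m)
  | or (i j : Fin m)

/-- The value of a gate, given the values of the earlier wires. -/
def Gate.eval {m : ℕ} (v : Fin m → Bool) : Gate m → Bool
  | .const b => b
  | .not i => !(v i)
  | .and i j => v i && v j
  | .or i j => v i || v j

/-- Topologically ordered lists of `k` gates on `n` inputs. Wires `0, …, n - 1` are the inputs and
wire `n + j` is the output of gate `j`; a gate may read every earlier wire, with unbounded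
fan-out. -/
inductive Gates (n : ℕ) : ℕ → Type
  | nil : Gates n 0
  | snoc {k : ℕ} (C : Gates n k) (g : Gate (n + k)) : Gates n (k + 1)

/-- The values of all wires on input `x`. -/
def Gates.values {n : ℕ} (x : Fin n → Bool) : {k : ℕ} → Gates n k → Fin (n + k) → Bool
  | _, .nil => x
  | _, .snoc (k := k) C g =>
      Fin.snoc (n := n + k) (α := fun _ => Bool) (C.values x) (g.eval (C.values x))

/-- A Boolean circuit with `n` inputs and one output; its size is the number of gates. -/
structure Circuit (n : ℕ) where
  size : ℕ
  gates : Gates n size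
  out : Fin (n + size)

/-- The Boolean function computed by a circuit. -/
def Circuit.eval {n : ℕ} (C : Circuit n) (x : Fin n → Bool) : Bool :=
  C.gates.values x C.out

/-- `f` has circuit complexity at most `s`. -/
def CircuitComplexityLE {n : ℕ} (f : (Fin n → Bool) → Bool) (s : ℕ) : Prop :=
  ∃ C : Circuit n, C.size ≤ s ∧ ∀ x, C.eval x = f x

/-! ### Circuits as bit strings -/

/-- A gate is described by three numbers: its kind and its two arguments. -/
def Gate.code {m : ℕ} : Gate m → List ℕ
  | .const b => [0, b.toNat, 0]
  | .not i => [1, i, 0]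
  | .and i j => [2, i, j]
  | .or i j => [3, i, j]

/-- The descriptions of the gates, last gate first. -/
def Gates.code {n : ℕ} : {k : ℕ} → Gates n k → List ℕ
  | _, .nil => []
  | _, .snoc C g => g.code ++ C.code

/-- A list of numbers as a bit string: each number in unary, terminated by `0`. -/
def bits : List ℕ → List Bool
  | [] => []
  | a :: l => List.replicate a true ++ false :: bits l

/-- The bit string that describes a circuit. Its length is polynomial in the size of the circuit
and its number of inputs. -/
def Circuit.encode {n : ℕ} (C : Circuit n) : List Bool :=
  bits (C.out.val :: C.gates.code)

/-- The bit string `w` describes a circuit for `f`. -/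
def IsCircuitFor {n : ℕ} (f : (Fin n → Bool) → Bool) (w : List Bool) : Prop :=
  ∃ C : Circuit n, C.encode = w ∧ ∀ x, C.eval x = f x

theorem bits_injective : Function.Injective bits := by
  intro l
  induction l with
  | nil =>
    intro l' h
    cases l' with
    | nil => rfl
    | cons a l' => cases a <;> simp [bits, List.replicate_succ] at h
  | cons a l ih =>
    intro l' h
    cases l' with
    | nil => cases a <;> simp [bits, List.replicate_succ] at h
    | cons b l' =>
      have key : ∀ a b : ℕ, bits (a :: l) = bits (b :: l') → a = b ∧ bits l = bits l' := by
        intro a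
        induction a with
        | zero => intro b hb; cases b <;> simp_all [bits, List.replicate_succ]
        | succ a iha =>
          intro b hb
          cases b with
          | zero => simp [bits, List.replicate_succ] at hb
          | succ b =>
            have h2 : bits (a :: l) = bits (b :: l') := by
              simpa [bits, List.replicate_succ] using hb
            obtain ⟨h3, h4⟩ := iha b h2
            exact ⟨by omega, h4⟩
      obtain ⟨h1, h2⟩ := key a b h
      rw [h1, ih h2]

theorem Gate.code_append_injective {m : ℕ} {g g' : Gate m} {l l' : List ℕ}
    (h : g.code ++ l = g'.code ++ l') : g = g' ∧ l = l' := by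
  cases g <;> cases g' <;> simp_all [Gate.code, Fin.ext_iff]
  rename_i b b'
  cases b <;> cases b' <;> simp_all

theorem Gates.code_length {n k : ℕ} (C : Gates n k) : C.code.length = 3 * k := by
  induction C with
  | nil => rfl
  | snoc C g ih => cases g <;> simp [Gates.code, Gate.code, ih] <;> omega

theorem Gates.code_injective {n k : ℕ} (C C' : Gates n k) (h : C.code = C'.code) : C = C' := by
  induction C with
  | nil => cases C'; rfl
  | snoc C g ih =>
    cases C' with
    | snoc C' g' =>
      obtain ⟨h1, h2⟩ := Gate.code_append_injective h
      rw [h1, ih C' h2]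

/-- A bit string describes at most one circuit. -/
theorem Circuit.encode_injective {n : ℕ} : Function.Injective (Circuit.encode (n := n)) := by
  rintro ⟨k, C, o⟩ ⟨k', C', o'⟩ h
  have h1 := bits_injective h
  simp only [List.cons.injEq] at h1
  obtain ⟨ho, hc⟩ := h1
  have hk : k = k' := by
    have := congrArg List.length hc
    rw [Gates.code_length, Gates.code_length] at this
    omega
  subst hk
  rw [Gates.code_injective C C' hc, Fin.ext ho]

/-! ### Oracle machines -/

/-- The stacks through which a machine communicates. -/
inductive Port : Type
  | input | coins | query | message | address | reply | output
  deriving DecidableEq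

/-- The instruction at a label: an ordinary finite piece of multi-stack code, or a query to the
oracle, or a message to a prover. -/
inductive Instr (K L S : Type) : Type
  | compute (q : Turing.TM2.Stmt (fun _ : K => Bool) L S)
  | query (next : Bool → L)
  | send (next : L)

/-- An oracle machine that may also exchange messages with provers: a multi-stack (equivalently,
multi-tape) Turing machine with finitely many stacks, labels and internal states. The stacks hold
bits; popping an empty stack is detected by the machine. -/
structure Machine where
  Work : Type
  L : Type
  S : Type
  [workFin : Fintype Work]
  [workDec : DecidableEq Work]
  [labelFin : Fintype L]
  [stateFin : Fintype S]
  start : L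
  init : S
  /-- when the machine halts in internal state `v`, it accepts if `accept v`, else it rejects -/
  accept : S → Bool
  instr : L → Instr (Port ⊕ Work) L S

attribute [instance] Machine.workFin Machine.workDec Machine.labelFin Machine.stateFin

/-- A message of length at most `B`. -/
abbrev Msg (B : ℕ) : Type := {w : List Bool // w.length ≤ B}

/-- The messages sent by the machine, most recent first, each with the number of the prover to
which it is addressed. -/
abbrev Transcript : Type := List (ℕ × List Bool)

/-- How the outside world answers the most recent message of a transcript. -/
abbrev Responder (B : ℕ) : Type := Transcript → Msg B

/-- A configuration: the label (`none` when halted), internal state and stacks, and the messages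
sent so far. -/
structure Config (M : Machine) where
  cfg : Turing.TM2.Cfg (fun _ : Port ⊕ M.Work => Bool) M.L M.S
  sent : Transcript

/-- A Boolean function on `n` bits as an oracle; words of another length are answered `0`. -/
def oracle {n : ℕ} (f : (Fin n → Bool) → Bool) (w : List Bool) : Bool :=
  if h : w.length = n then f (fun i => w.get (i.cast h.symm)) else false

/-- One step. A query asks the oracle about the word on the query stack, removes it, and branches
on the answer. Sending delivers the word on the message stack to the prover whose number is the
height of the address stack, empties these two stacks, and puts the reply on the reply stack in
place of what was there. A halted machine stays as it is. -/
def Machine.step (M : Machine) (O : List Bool → Bool) {B : ℕ} (P : Responder B)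
    (c : Config M) : Config M :=
  match c.cfg.l with
  | none => c
  | some l =>
    match M.instr l with
    | .compute q => ⟨Turing.TM2.stepAux q c.cfg.var c.cfg.stk, c.sent⟩
    | .query next =>
      ⟨⟨some (next (O (c.cfg.stk (.inl .query)))), c.cfg.var,
        Function.update c.cfg.stk (.inl .query) []⟩, c.sent⟩
    | .send next =>
      let sent := ((c.cfg.stk (.inl .address)).length, c.cfg.stk (.inl .message)) :: c.sent
      ⟨⟨some next, c.cfg.var,
        Function.update (Function.update (Function.update c.cfg.stk
          (.inl .message) []) (.inl .address) []) (.inl .reply) (P sent).1⟩, sent⟩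

/-- The initial configuration with the given words on the input, coin and reply stacks. -/
def Machine.initial (M : Machine) (x r w : List Bool) : Config M :=
  ⟨⟨some M.start, M.init, fun k =>
    match k with
    | .inl .input => x
    | .inl .coins => r
    | .inl .reply => w
    | _ => []⟩, []⟩

/-- The result of a run with clock `T`: the word on the output stack if the machine halts within
`T` steps and accepts, and `none` if it rejects or has not halted. -/
def Machine.result (M : Machine) (O : List Bool → Bool) {B : ℕ} (P : Responder B) (T : ℕ)
    (x r w : List Bool) : Option (List Bool) :=
  let c := ((M.step O P)^[T] (M.initial x r w)).cfg
  if c.l = none ∧ M.accept c.var = true then some (c.stk (.inl .output)) else none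

/-! ### Proof systems -/

/-- The fraction of the strings `r` of `m` coins for which `E r` holds. -/
noncomputable def prob (m : ℕ) (E : (Fin m → Bool) → Prop) : ℝ :=
  (Nat.card {r : Fin m → Bool // E r} : ℝ) / 2 ^ m

/-- No prover: every reply is empty. -/
def noReply (B : ℕ) : Responder B := fun _ => ⟨[], Nat.zero_le B⟩

/-- Provers that cannot communicate: the reply of prover `i` depends only on the messages that
prover `i` has received so far (most recent first). -/
def separate {B : ℕ} (P : ℕ → List (List Bool) → Msg B) : Responder B
  | [] => noReply B []
  | (i, m) :: h => P i (m :: (h.filter (fun e => e.1 = i)).map Prod.snd)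

inductive ProofSystem : Type
  | NP | AM | IP | MIP

/-- Completeness on input `x` with oracle `O` and bound `B`: some prover makes the machine accept
with an output in `A`, with probability at least `2/3` over the coins if the machine is
probabilistic. The number of steps, the number of coins and the length of every message from a
prover are at most `B`.
* `NP`: the machine is deterministic, given a proof `w` (equivalently, its nondeterministic
  guesses).
* `AM`: the machine's coins `r` are shown to the prover, who sends one message.
* `IP`: private coins; in each round the prover answers on the basis of all messages sent so far.
* `MIP`: private coins, several separate provers. -/
def Complete (X : ProofSystem) (M : Machine) (O : List Bool → Bool) (B : ℕ) (x : List Bool)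
    (A : Set (List Bool)) : Prop :=
  match X with
  | .NP => ∃ w : Msg B, ∃ o ∈ A, M.result O (noReply B) B x [] w.1 = some o
  | .AM => ∃ P : (Fin B → Bool) → Msg B,
      2 / 3 ≤ prob B fun r => ∃ o ∈ A, M.result O (noReply B) B x (List.ofFn r) (P r).1 = some o
  | .IP => ∃ P : Responder B,
      2 / 3 ≤ prob B fun r => ∃ o ∈ A, M.result O P B x (List.ofFn r) [] = some o
  | .MIP => ∃ P : ℕ → List (List Bool) → Msg B,
      2 / 3 ≤ prob B fun r => ∃ o ∈ A, M.result O (separate P) B x (List.ofFn r) [] = some o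

/-- Soundness: whatever the provers do, the machine does not accept with an output in `A`, except
with probability at most `1/3` if it is probabilistic. -/
def Sound (X : ProofSystem) (M : Machine) (O : List Bool → Bool) (B : ℕ) (x : List Bool)
    (A : Set (List Bool)) : Prop :=
  match X with
  | .NP => ∀ w : Msg B, ¬ ∃ o ∈ A, M.result O (noReply B) B x [] w.1 = some o
  | .AM => ∀ P : (Fin B → Bool) → Msg B,
      prob B (fun r => ∃ o ∈ A, M.result O (noReply B) B x (List.ofFn r) (P r).1 = some o) ≤ 1 / 3
  | .IP => ∀ P : Responder B,
      prob B (fun r => ∃ o ∈ A, M.result O P B x (List.ofFn r) [] = some o) ≤ 1 / 3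
  | .MIP => ∀ P : ℕ → List (List Bool) → Msg B,
      prob B (fun r => ∃ o ∈ A, M.result O (separate P) B x (List.ofFn r) [] = some o) ≤ 1 / 3

/-! ### Black-box learning -/

/-- The input `⟨0^n, 0^s⟩`. -/
def unaryPair (n s : ℕ) : List Bool :=
  List.replicate n false ++ true :: List.replicate s false

/-- The machine `M`, with resources bounded by the polynomial `p` in the length of its input,
outputs a circuit for `f` on input `⟨0^n, 0^s⟩` with oracle `f`, in the sense of the function
version of `X`. -/
def Learns (X : ProofSystem) (M : Machine) (p : Polynomial ℕ) {n : ℕ}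
    (f : (Fin n → Bool) → Bool) (s : ℕ) : Prop :=
  Complete X M (oracle f) (p.eval (unaryPair n s).length) (unaryPair n s) {w | IsCircuitFor f w} ∧
  Sound X M (oracle f) (p.eval (unaryPair n s).length) (unaryPair n s) {w | ¬ IsCircuitFor f w}

/-- Black-box learning of the functions of circuit complexity at most `s(n)` is possible in `X`. -/
def LearningPossible (X : ProofSystem) (s : ℕ → ℕ) : Prop :=
  ∃ (M : Machine) (p : Polynomial ℕ), ∀ (n : ℕ) (f : (Fin n → Bool) → Bool),
    CircuitComplexityLE f (s n) → Learns X M p f (s n)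

/-- The point function at `y`. -/
def point {n : ℕ} (y : Fin n → Bool) : (Fin n → Bool) → Bool := fun x => decide (x = y)

/-- On input `⟨0^n, 0^s⟩`, the provers can convince `M` that its oracle on `n` bits is identically
zero when it is, and cannot when it is a point function. -/
def CertifiesZero (X : ProofSystem) (M : Machine) (p : Polynomial ℕ) (n s : ℕ) : Prop :=
  Complete X M (oracle fun _ : Fin n → Bool => false)
    (p.eval (unaryPair n s).length) (unaryPair n s) Set.univ ∧
  ∀ y : Fin n → Bool, Sound X M (oracle (point y))
    (p.eval (unaryPair n s).length) (unaryPair n s) Set.univ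

/-- `s` is bounded by a polynomial. -/
def PolyBounded (s : ℕ → ℕ) : Prop := ∃ q : Polynomial ℕ, ∀ n, s n ≤ q.eval n

end BlackBox

namespace BlackBox

/-! ### Circuits for point functions -/

/-! The proof is an adversary argument. Fix a prover strategy that succeeds when the oracle is zero.
For fixed coins the run is deterministic and asks at most `B` queries, where `B` is the clock. If
the oracle is replaced by the point function at `y` and the provers do not change their strategy,
the run is literally the same unless it asks about `y` (`Machine.result_point_eq`,
`Machine.card_queried_le`). Averaging over the `2 ^ n` points gives a `y` that is queried with
probability at most `B / 2 ^ n < 1/3`, so the success probability stays above `2/3 - 1/3 = 1/3` at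
this `y` (`exists_one_third_lt_prob`). Neither the form of the interaction nor the length of the
messages plays a role, only the number of queries; hence one lemma, `Complete.exists_not_sound`,
serves all four classes. For certification every accepting run counts as success. For learning,
success means outputting a circuit for zero: such an output is wrong for a point function, and both
functions have linear-size circuits. -/

theorem Gates.values_castAdd {n k : ℕ} (C : Gates n k) (x : Fin n → Bool) (i : Fin n) :
    C.values x (Fin.castAdd k i) = x i := by
  induction C with
  | nil => rfl
  | snoc C g ih =>
    rename_i k
    have h : (Fin.castAdd (k + 1) i : Fin (n + k + 1)) = (Fin.castAdd k i).castSucc := rfl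
    simp only [Gates.values]
    exact (congrArg _ h).trans ((Fin.snoc_castSucc (α := fun _ => Bool) _ _ _).trans ih)

theorem Gates.values_snoc_castSucc {n k : ℕ} (C : Gates n k) (g : Gate (n + k))
    (x : Fin n → Bool) (i : Fin (n + k)) :
    (C.snoc g).values x (i.castSucc : Fin (n + k + 1)) = C.values x i := by
  simp only [Gates.values]
  exact Fin.snoc_castSucc (α := fun _ => Bool) _ _ _

theorem Gates.values_snoc_last {n k : ℕ} (C : Gates n k) (g : Gate (n + k)) (x : Fin n → Bool) :
    (C.snoc g).values x (Fin.last (n + k)) = g.eval (C.values x) := by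
  simp only [Gates.values]
  exact Fin.snoc_last (α := fun _ => Bool) _ _

/-- The conjunction of literals is built one coordinate at a time: an AND gate for each, a NOT gate
where `y` is `0`, and one constant gate for the empty conjunction. -/
theorem exists_gates_prefix {n : ℕ} (y : Fin n → Bool) (k : ℕ) (hk : k ≤ n) :
    ∃ (m : ℕ) (C : Gates n m) (o : Fin (n + m)), m ≤ 2 * k + 1 ∧
      ∀ x, C.values x o = true ↔ ∀ i : Fin n, i.val < k → x i = y i := by
  induction k with
  | zero =>
    exact ⟨1, Gates.nil.snoc (.const true), Fin.last n, le_rfl, fun x =>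
      ⟨fun _ i hi => absurd hi (Nat.not_lt_zero _),
        fun _ => Gates.values_snoc_last (n := n) (k := 0) Gates.nil (.const true) x⟩⟩
  | succ k ih =>
    obtain ⟨m, C, o, hm, h⟩ := ih (by omega)
    have split : ∀ x : Fin n → Bool, (∀ i : Fin n, i.val < k + 1 → x i = y i) ↔
        (∀ i : Fin n, i.val < k → x i = y i) ∧ x ⟨k, hk⟩ = y ⟨k, hk⟩ := by
      refine fun x => ⟨fun H => ⟨fun i hi => H i (by omega), H _ (Nat.lt_succ_self k)⟩, ?_⟩
      rintro ⟨H, H'⟩ i hi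
      rcases Nat.lt_succ_iff_lt_or_eq.1 hi with hi | rfl
      · exact H i hi
      · exact H'
    cases hy : y ⟨k, hk⟩ with
    | true =>
      refine ⟨m + 1, C.snoc (.and o (Fin.castAdd m ⟨k, hk⟩)), Fin.last (n + m), by omega,
        fun x => ?_⟩
      rw [Gates.values_snoc_last, split, ← h, hy, Gate.eval, Gates.values_castAdd,
        Bool.and_eq_true]
    | false =>
      refine ⟨m + 2, (C.snoc (.not (Fin.castAdd m ⟨k, hk⟩))).snoc
        (.and o.castSucc (Fin.last (n + m))), Fin.last (n + (m + 1)), by omega, fun x => ?_⟩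
      rw [Gates.values_snoc_last, split, ← h, hy, Gate.eval, Gates.values_snoc_castSucc,
        Gates.values_snoc_last, Gate.eval, Gates.values_castAdd, Bool.and_eq_true,
        Bool.not_eq_true']

theorem circuitComplexityLE_point {n : ℕ} (y : Fin n → Bool) :
    CircuitComplexityLE (point y) (2 * n + 1) := by
  obtain ⟨m, C, o, hm, h⟩ := exists_gates_prefix y n le_rfl
  refine ⟨⟨m, C, o⟩, hm, fun x => ?_⟩
  rw [Bool.eq_iff_iff]
  refine (h x).trans ?_
  simp [point, funext_iff]

theorem circuitComplexityLE_zero (n : ℕ) :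
    CircuitComplexityLE (fun _ : Fin n → Bool => false) 1 :=
  ⟨⟨1, Gates.nil.snoc (.const false), Fin.last n⟩, le_rfl, fun x =>
    Gates.values_snoc_last (n := n) (k := 0) Gates.nil (.const false) x⟩

theorem CircuitComplexityLE.mono {n s t : ℕ} {f : (Fin n → Bool) → Bool}
    (h : CircuitComplexityLE f s) (hst : s ≤ t) : CircuitComplexityLE f t :=
  let ⟨C, hC, hf⟩ := h
  ⟨C, hC.trans hst, hf⟩

/-- A description determines its circuit, hence the function; so a correct output for zero is a
wrong output for every point function. -/
theorem IsCircuitFor.unique {n : ℕ} {f g : (Fin n → Bool) → Bool} {w : List Bool}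
    (hf : IsCircuitFor f w) (hg : IsCircuitFor g w) : f = g := by
  obtain ⟨C, hC, hCf⟩ := hf
  obtain ⟨D, hD, hDg⟩ := hg
  obtain rfl := Circuit.encode_injective (hC.trans hD.symm)
  exact funext fun x => (hCf x).symm.trans (hDg x)

/-! ### The queries of a run -/

/-- The word about which the oracle is asked in the next step, if there is one. -/
def Machine.queryWord (M : Machine) (c : Config M) : Option (List Bool) :=
  match c.cfg.l with
  | none => none
  | some l =>
    match M.instr l with
    | .query _ => some (c.cfg.stk (.inl .query))
    | _ => none

theorem Machine.step_congr (M : Machine) {O O' : List Bool → Bool} {B : ℕ} (P : Responder B)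
    (c : Config M) (h : ∀ w, M.queryWord c = some w → O w = O' w) :
    M.step O P c = M.step O' P c := by
  unfold Machine.step
  unfold Machine.queryWord at h
  split
  · rfl
  · rename_i l hl
    simp only [hl] at h
    split
    · rfl
    · rename_i next hq
      simp only [hq] at h
      rw [h _ rfl]
    · rfl

/-- Agreement of the oracles is needed only at the words asked along the run with `O`: as long as
the two runs coincide, the run with `O'` asks the same words. -/
theorem Machine.iterate_step_congr (M : Machine) {O O' : List Bool → Bool} {B : ℕ}
    (P : Responder B) (c : Config M) (T : ℕ)
    (h : ∀ i < T, ∀ w, M.queryWord ((M.step O P)^[i] c) = some w → O w = O' w) :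
    (M.step O P)^[T] c = (M.step O' P)^[T] c := by
  induction T with
  | zero => rfl
  | succ T ih =>
    rw [Function.iterate_succ_apply', Function.iterate_succ_apply',
      ← ih fun i hi => h i (by omega)]
    exact M.step_congr P _ (h T (Nat.lt_succ_self T))

open Classical in
/-- The points about which the oracle is asked in the first `T` steps from `c`. -/
noncomputable def Machine.queried (M : Machine) (O : List Bool → Bool) {B : ℕ} (P : Responder B)
    (n T : ℕ) (c : Config M) : Finset (Fin n → Bool) :=
  {y | ∃ i < T, M.queryWord ((M.step O P)^[i] c) = some (List.ofFn y)}

theorem Machine.card_queried_le (M : Machine) (O : List Bool → Bool) {B : ℕ} (P : Responder B)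
    (n T : ℕ) (c : Config M) : (M.queried O P n T c).card ≤ T := by
  classical
  -- Each step asks at most one word. The default values, for steps without a query or with a short
  -- word, can only enlarge the image.
  let g : ℕ → Fin n → Bool := fun i j =>
    ((M.queryWord ((M.step O P)^[i] c)).getD []).getD j false
  have hsub : M.queried O P n T c ⊆ (Finset.range T).image g := by
    intro y hy
    obtain ⟨i, hi, h⟩ := (Finset.mem_filter.1 hy).2
    refine Finset.mem_image.2 ⟨i, Finset.mem_range.2 hi, funext fun j => ?_⟩
    simp [g, h]
  calc _ ≤ ((Finset.range T).image g).card := Finset.card_le_card hsub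
    _ ≤ (Finset.range T).card := Finset.card_image_le
    _ = T := Finset.card_range T

theorem oracle_point_eq_of_ne {n : ℕ} (y : Fin n → Bool) (w : List Bool)
    (h : w ≠ List.ofFn y) : oracle (fun _ : Fin n → Bool => false) w = oracle (point y) w := by
  unfold oracle
  split
  · rename_i hw
    subst hw
    symm
    simp only [point, decide_eq_false_iff_not]
    intro hy
    exact h (by rw [← hy]; exact (List.ofFn_get w).symm)
  · rfl

/-- The queries are those of the run with the zero oracle, so they do not depend on `y`, which is
what permits averaging over `y`. The responder is a fixed function of the transcript, so its replies
agree as well. -/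
theorem Machine.result_point_eq (M : Machine) {B n T : ℕ} (P : Responder B)
    (y : Fin n → Bool) (x r w : List Bool)
    (h : y ∉ M.queried (oracle fun _ : Fin n → Bool => false) P n T (M.initial x r w)) :
    M.result (oracle (point y)) P T x r w =
      M.result (oracle fun _ : Fin n → Bool => false) P T x r w := by
  symm
  unfold Machine.result
  rw [M.iterate_step_congr P _ T]
  intro i hi w' hw
  refine oracle_point_eq_of_ne y w' fun hy => h ?_
  simp only [Machine.queried, Finset.mem_filter_univ]
  exact ⟨i, hi, hy ▸ hw⟩

/-! ### Averaging over the points -/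

/-- Double counting of the pairs `(y, r)` with `y ∈ Q r`; the minimum over `y` is at most the
average. -/
theorem exists_rarely_mem {α ι : Type*} [Fintype α] [DecidableEq α] [Nonempty α] [Fintype ι]
    (Q : ι → Finset α) {T : ℕ} (hQ : ∀ r, (Q r).card ≤ T) :
    ∃ y, Fintype.card α * (Finset.univ.filter fun r => y ∈ Q r).card ≤ Fintype.card ι * T := by
  have hsum : ∑ y, (Finset.univ.filter fun r => y ∈ Q r).card ≤ Fintype.card ι * T := by
    calc ∑ y, (Finset.univ.filter fun r => y ∈ Q r).card = ∑ r, (Q r).card := by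
          simp only [Finset.card_filter]
          rw [Finset.sum_comm]
          simp
      _ ≤ ∑ _r : ι, T := Finset.sum_le_sum fun r _ => hQ r
      _ = Fintype.card ι * T := by simp
  obtain ⟨y, -, hy⟩ := Finset.exists_min_image Finset.univ
    (fun y => (Finset.univ.filter fun r => y ∈ Q r).card) Finset.univ_nonempty
  refine ⟨y, le_trans ?_ hsum⟩
  simpa using Finset.card_nsmul_le_sum Finset.univ _ _ fun z hz => hy z hz

/-- If an event of probability at least `2/3` does not change at `y` unless `y ∈ Q r`, for few
points `y`, then at some `y` its probability is still above `1/3`. -/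
theorem exists_one_third_lt_prob {n T m : ℕ} (hT : 3 * T < 2 ^ n)
    (Q : (Fin m → Bool) → Finset (Fin n → Bool)) (hQ : ∀ r, (Q r).card ≤ T)
    (E : (Fin m → Bool) → Prop) (E' : (Fin n → Bool) → (Fin m → Bool) → Prop)
    (hE : ∀ y r, y ∉ Q r → E r → E' y r) (h : 2 / 3 ≤ prob m E) :
    ∃ y, 1 / 3 < prob m (E' y) := by
  classical
  obtain ⟨y, hy⟩ := exists_rarely_mem Q hQ
  refine ⟨y, ?_⟩
  -- Union bound: where `E` holds, either `E' y` holds or `y` is queried.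
  have hcard : Nat.card {r // E r} ≤
      Nat.card {r // E' y r} + (Finset.univ.filter fun r => y ∈ Q r).card := by
    rw [Nat.card_eq_fintype_card, Nat.card_eq_fintype_card, Fintype.card_subtype,
      Fintype.card_subtype]
    refine (Finset.card_le_card fun r hr => ?_).trans (Finset.card_union_le _ _)
    by_cases hq : y ∈ Q r
    · simp [hq]
    · simp [hE y r hq (Finset.mem_filter.1 hr).2]
  simp only [Fintype.card_fun, Fintype.card_bool, Fintype.card_fin] at hy
  have hm : (0 : ℝ) < 2 ^ m := by positivity
  -- The chosen `y` is queried for at most a fraction `T / 2 ^ n` of the coin strings, which `hT`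
  -- makes less than `1/3`.
  have hrare : 3 * (Finset.univ.filter fun r => y ∈ Q r).card < 2 ^ m := by
    by_contra hc
    have h1 : 2 ^ n * 2 ^ m ≤ 2 ^ m * (3 * T) := by
      calc 2 ^ n * 2 ^ m ≤ 2 ^ n * (3 * (Finset.univ.filter fun r => y ∈ Q r).card) :=
            Nat.mul_le_mul_left _ (not_lt.1 hc)
        _ = 3 * (2 ^ n * (Finset.univ.filter fun r => y ∈ Q r).card) := by ring
        _ ≤ 3 * (2 ^ m * T) := Nat.mul_le_mul_left _ hy
        _ = 2 ^ m * (3 * T) := by ring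
    rw [mul_comm] at h1
    exact absurd (Nat.le_of_mul_le_mul_left h1 (by positivity)) (not_le.2 hT)
  unfold prob at h ⊢
  rw [le_div_iff₀ hm] at h
  rw [lt_div_iff₀ hm]
  have hcard' : (Nat.card {r // E r} : ℝ) ≤
      Nat.card {r // E' y r} + ((Finset.univ.filter fun r => y ∈ Q r).card : ℝ) := by
    exact_mod_cast hcard
  have hrare' : 3 * ((Finset.univ.filter fun r => y ∈ Q r).card : ℝ) < 2 ^ m := by
    exact_mod_cast hrare
  linarith

/-! ### Few queries do not distinguish zero from all point functions -/

/-- The strategy that is honest for zero becomes the cheating strategy at `y`. Without coins any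
unqueried `y` will do; with coins, a rarely queried one. In `AM` the message depends on the coins,
so the query set is taken for the pair of coins and message. -/
theorem Complete.exists_not_sound {X : ProofSystem} {M : Machine} {n B : ℕ} {x : List Bool}
    {A : Set (List Bool)} (hB : 3 * B < 2 ^ n)
    (h : Complete X M (oracle fun _ : Fin n → Bool => false) B x A) :
    ∃ y : Fin n → Bool, ¬ Sound X M (oracle (point y)) B x A := by
  cases X with
  | NP =>
    obtain ⟨w, o, ho, hw⟩ := h
    obtain ⟨y, hy⟩ : ∃ y, y ∉ M.queried (oracle fun _ : Fin n → Bool => false) (noReply B) n B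
        (M.initial x [] w.1) := by
      by_contra! hall
      have h1 := M.card_queried_le (oracle fun _ : Fin n → Bool => false) (noReply B) n B
        (M.initial x [] w.1)
      rw [Finset.eq_univ_iff_forall.2 hall, Finset.card_univ, Fintype.card_fun, Fintype.card_bool,
        Fintype.card_fin] at h1
      omega
    exact ⟨y, fun hs => hs w ⟨o, ho, (M.result_point_eq _ y x [] w.1 hy).trans hw⟩⟩
  | AM =>
    obtain ⟨P, hP⟩ := h
    obtain ⟨y, hy⟩ := exists_one_third_lt_prob hB _ (fun r => M.card_queried_le _ (noReply B) n B
      (M.initial x (List.ofFn r) (P r).1)) _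
      (fun y r => ∃ o ∈ A, M.result (oracle (point y)) (noReply B) B x (List.ofFn r) (P r).1 =
        some o) (fun y r hy => by rw [M.result_point_eq _ y _ _ _ hy]; exact id) hP
    exact ⟨y, fun hs => (hs P).not_gt hy⟩
  | IP =>
    obtain ⟨P, hP⟩ := h
    obtain ⟨y, hy⟩ := exists_one_third_lt_prob hB _ (fun r => M.card_queried_le _ P n B
      (M.initial x (List.ofFn r) [])) _
      (fun y r => ∃ o ∈ A, M.result (oracle (point y)) P B x (List.ofFn r) [] = some o)
      (fun y r hy => by rw [M.result_point_eq _ y _ _ _ hy]; exact id) hP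
    exact ⟨y, fun hs => (hs P).not_gt hy⟩
  | MIP =>
    obtain ⟨P, hP⟩ := h
    obtain ⟨y, hy⟩ := exists_one_third_lt_prob hB _ (fun r => M.card_queried_le _ (separate P) n B
      (M.initial x (List.ofFn r) [])) _
      (fun y r => ∃ o ∈ A, M.result (oracle (point y)) (separate P) B x (List.ofFn r) [] = some o)
      (fun y r hy => by rw [M.result_point_eq _ y _ _ _ hy]; exact id) hP
    exact ⟨y, fun hs => (hs P).not_gt hy⟩

theorem prob_mono {m : ℕ} {E E' : (Fin m → Bool) → Prop} (h : ∀ r, E r → E' r) :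
    prob m E ≤ prob m E' := by
  unfold prob
  refine div_le_div_of_nonneg_right ?_ (by positivity)
  exact_mod_cast Nat.card_mono (Set.toFinite {r | E' r}) h

theorem Sound.mono {X : ProofSystem} {M : Machine} {O : List Bool → Bool} {B : ℕ} {x : List Bool}
    {A A' : Set (List Bool)} (h : Sound X M O B x A') (hA : A ⊆ A') : Sound X M O B x A := by
  cases X with
  | NP => exact fun w ⟨o, ho, hw⟩ => h w ⟨o, hA ho, hw⟩
  | AM => exact fun P => (prob_mono fun _ ⟨o, ho, hw⟩ => ⟨o, hA ho, hw⟩).trans (h P)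
  | IP => exact fun P => (prob_mono fun _ ⟨o, ho, hw⟩ => ⟨o, hA ho, hw⟩).trans (h P)
  | MIP => exact fun P => (prob_mono fun _ ⟨o, ho, hw⟩ => ⟨o, hA ho, hw⟩).trans (h P)

/-! ### Polynomial clocks -/

theorem eval_isLittleO_two_pow (p : Polynomial ℕ) :
    (fun n : ℕ => ((p.eval n : ℕ) : ℝ)) =o[Filter.atTop] fun n : ℕ => (2 : ℝ) ^ n := by
  induction p using Polynomial.induction_on' with
  | add p q hp hq => simpa using hp.add hq
  | monomial k a =>
    simpa using (isLittleO_pow_const_const_pow_of_one_lt k (one_lt_two (α := ℝ))).const_mul_left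
      (a : ℝ)

/-- Coefficients in `ℕ` are nonnegative, so each monomial is monotone. -/
theorem eval_mono (p : Polynomial ℕ) : Monotone fun n => p.eval n := by
  intro a b hab
  simp only [Polynomial.eval_eq_sum, Polynomial.sum_def]
  exact Finset.sum_le_sum fun i _ => by gcongr

theorem eventually_clock_lt {s : ℕ → ℕ} (hs : PolyBounded s) (p : Polynomial ℕ) :
    ∀ᶠ n in Filter.atTop, 3 * p.eval (unaryPair n (s n)).length < 2 ^ n := by
  obtain ⟨q, hq⟩ := hs
  -- The input has length `n + 1 + s n`, bounded by `X + (q + 1)` at `n`. The constant `1/4` leaves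
  -- room for the factor `3`, as `3/4 < 1`.
  have h := (eval_isLittleO_two_pow (p.comp (Polynomial.X + (q + 1)))).bound
    (show (0 : ℝ) < 1 / 4 by norm_num)
  filter_upwards [h] with n hn
  have h1 : p.eval (unaryPair n (s n)).length ≤ (p.comp (Polynomial.X + (q + 1))).eval n := by
    rw [Polynomial.eval_comp]
    refine eval_mono p ?_
    simpa [unaryPair] using hq n
  have h2 : ((p.eval (unaryPair n (s n)).length : ℕ) : ℝ) ≤
      ((p.comp (Polynomial.X + (q + 1))).eval n : ℕ) := by exact_mod_cast h1
  rw [Real.norm_of_nonneg (by positivity), Real.norm_of_nonneg (by positivity)] at hn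
  have h3 : (0 : ℝ) < 2 ^ n := by positivity
  have h4 : 3 * ((p.eval (unaryPair n (s n)).length : ℕ) : ℝ) < 2 ^ n := by linarith
  exact_mod_cast h4

/-- Completeness for zero and soundness for a point function clash on the set of descriptions of
circuits for zero, since `Sound.mono` restricts soundness to this subset of the wrong outputs. -/
theorem not_learningPossible {s : ℕ → ℕ} (hlin : ∀ n, 3 * n ≤ s n) (hs : PolyBounded s)
    (X : ProofSystem) : ¬ LearningPossible X s := by
  rintro ⟨M, p, hM⟩
  -- With `n ≥ 1`, the bound `3 * n` covers both the size `2 * n + 1` of a point function and the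
  -- size `1` of zero.
  obtain ⟨n, hn, hpos⟩ := ((eventually_clock_lt hs p).and (Filter.eventually_ge_atTop 1)).exists
  have hsn := hlin n
  obtain ⟨y, hy⟩ := Complete.exists_not_sound hn
    (hM n _ ((circuitComplexityLE_zero n).mono (by omega))).1
  refine hy ((hM n _ ((circuitComplexityLE_point y).mono (by omega))).2.mono fun w hw hw' => ?_)
  -- Zero and the point function differ at `y`.
  simpa [point] using congrFun (IsCircuitFor.unique hw hw') y

end BlackBox

theorem mainTheorem9 :
    (∃ c : ℕ, ∀ s : ℕ → ℕ, (∀ n, c * n ≤ s n) → BlackBox.PolyBounded s →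
      ∀ X : BlackBox.ProofSystem, ¬ BlackBox.LearningPossible X s) ∧
    (∀ s : ℕ → ℕ, BlackBox.PolyBounded s →
      ∀ (X : BlackBox.ProofSystem) (M : BlackBox.Machine) (p : Polynomial ℕ),
        ∀ᶠ n in Filter.atTop, ¬ BlackBox.CertifiesZero X M p n (s n)) := by
  refine ⟨⟨3, fun s hlin hs X => BlackBox.not_learningPossible hlin hs X⟩, fun s hs X M p => ?_⟩
  filter_upwards [BlackBox.eventually_clock_lt hs p] with n hn
  rintro ⟨hc, hsound⟩
  obtain ⟨y, hy⟩ := hc.exists_not_sound hn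
  exact hy (hsound y)
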